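/- A multigraph is a finite undirected graph that may have multiple edges but has no loops. For a multigraph $G$ with vertex set $V$ and disjoint $S,T\subseteq V$, let $e(S,T)$ be the number of edges with one end in $S$ and the other in $T$. Let $\delta$ and $\Delta$ be the minimum and maximum degree of $G$; let its multiplicity $m$ be the maximum number of edges between any pair of vertices; let its edge connectivity $\kappa'(G)$ be the minimum of $e(S,V\setminus S)$ over all non-empty proper subsets $S$ of $V$; and let $\tau(G)$ be the maximum number of pairwise edge-disjoint spanning trees of $G$. Let $q_3(G)$ be the third largest eigenvalue, counted with multiplicity, of the signless Laplacian matrix $Q(G)=D(G)+A(G)$, where $D(G)$ is the diagonal matrix of vertex degrees and the $(u,v)$ entry of $A(G)$ is the number of edges between $u$ and $v$. Let $\mathcal{G}$ be the class of multigraphs $G$ for which there are two disjoint non-empty proper subsets $V_1,V_2\subseteq V$ with $V\setminus(V_1\cup V_2)\neq\emptyset$ and $\kappa'(G)=e(V_i,V\setminus V_i)$ for $i=1,2$. **Theorem.** Let $k\ge 2$ be an integer and let $G\in\mathcal{G}$ be a multigraph with multiplicity $m$ and minimum degree $\delta\ge 2k$. Set $l=\max\{\lceil(\delta+1)/m\rceil,2\}$.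 If $$q_3(G)<4\delta-2\Delta-\frac{2(3k-1)}{l},$$ then $\tau(G)\ge k$. -/

import Mathlib

open scoped Graph

noncomputable section

namespace Graph

variable {α β : Type*}

/-- `e(S, T)`: the number of edges of `G` with one end in `S` and the other end in `T`. -/
def numEdgesBetween (G : Graph α β) (S T : Set α) : ℕ :=
  {e : β | ∃ x ∈ S, ∃ y ∈ T, G.IsLink e x y}.ncard

/-- The number of edges of `G` joining `u` and `v`. -/
def numLinks (G : Graph α β) (u v : α) : ℕ :=
  {e : β | G.IsLink e u v}.ncard

/-- The degree of a vertex of a loopless multigraph: the number of edges incident with it. -/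
def vertexDegree (G : Graph α β) (v : α) : ℕ :=
  {e : β | G.Inc e v}.ncard

/-- The minimum degree `δ`. -/
def minDegree (G : Graph α β) : ℕ := ⨅ v : V(G), G.vertexDegree v

/-- The maximum degree `Δ`. -/
def maxDegree (G : Graph α β) : ℕ := ⨆ v : V(G), G.vertexDegree v

/-- The multiplicity of a loopless multigraph: the maximum number of edges between any pair of
vertices. -/
def multiplicity (G : Graph α β) : ℕ := ⨆ p : V(G) × V(G), G.numLinks p.1 p.2

/-- The edge connectivity `κ'`: the minimum size of an edge cut `E(S, V ∖ S)`, where `S` is a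
non-empty proper subset of the vertex set `V`. -/
def edgeConnectivity (G : Graph α β) : ℕ :=
  sInf {c : ℕ | ∃ S : Set α, S.Nonempty ∧ S ⊂ V(G) ∧ c = G.numEdgesBetween S (V(G) \ S)}

/-- The class `𝒢`: there are two disjoint non-empty proper subsets of the vertex set which do not
cover it and which both give a minimum edge cut. -/
def HasTwoMinCuts (G : Graph α β) : Prop :=
  ∃ V₁ V₂ : Set α, V₁.Nonempty ∧ V₂.Nonempty ∧ V₁ ⊂ V(G) ∧ V₂ ⊂ V(G) ∧ Disjoint V₁ V₂ ∧
    (V(G) \ (V₁ ∪ V₂)).Nonempty ∧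
    G.edgeConnectivity = G.numEdgesBetween V₁ (V(G) \ V₁) ∧
    G.edgeConnectivity = G.numEdgesBetween V₂ (V(G) \ V₂)

/-- A tree: a connected multigraph without cycles. Loops and pairs of parallel edges are cycles, so
a multigraph without cycles is simple, and the rest concerns the underlying simple graph. -/
def IsTree (T : Graph α β) : Prop := T.Simple ∧ T.toSimpleGraph.IsTree

/-- `T` is a spanning tree of `G`: a spanning subgraph which is a tree. -/
def IsSpanningTreeOf (T G : Graph α β) : Prop := T.IsSpanningSubgraph G ∧ T.IsTree

/-- The spanning tree packing number `τ`: the maximum number of pairwise edge-disjoint spanning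
trees. (Among finite graphs it is infinite only for one-vertex graphs, hence the values in `ℕ∞`.) -/
def treePackingNumber (G : Graph α β) : ℕ∞ :=
  ⨆ (k : ℕ) (_ : ∃ T : Fin k → Graph α β, (∀ i, (T i).IsSpanningTreeOf G) ∧
    Pairwise fun i j => Disjoint E(T i) E(T j)), (k : ℕ∞)

/-- The adjacency matrix `A`, whose entries count the edges between two vertices. -/
def adjacencyMatrix (G : Graph α β) : Matrix V(G) V(G) ℝ :=
  Matrix.of fun u v => (G.numLinks u v : ℝ)

/-- The diagonal matrix `D` of the vertex degrees. -/
def degreeMatrix (G : Graph α β) [DecidableEq V(G)] : Matrix V(G) V(G) ℝ :=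
  Matrix.diagonal fun v => (G.vertexDegree v : ℝ)

/-- The signless Laplacian matrix `Q = D + A`. -/
def signlessLaplacian (G : Graph α β) [DecidableEq V(G)] : Matrix V(G) V(G) ℝ :=
  G.degreeMatrix + G.adjacencyMatrix

theorem isHermitian_signlessLaplacian (G : Graph α β) [DecidableEq V(G)] :
    G.signlessLaplacian.IsHermitian := by
  ext u v
  have h : G.numLinks (v : α) u = G.numLinks u v := by
    simp only [numLinks, G.isLink_comm]
  by_cases huv : u = v
  · subst huv
    simp [signlessLaplacian, degreeMatrix, adjacencyMatrix]
  · simp [signlessLaplacian, degreeMatrix, adjacencyMatrix, Matrix.diagonal_apply_ne _ huv,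
      Matrix.diagonal_apply_ne _ (Ne.symm huv), h]

/-- `q i`: the `i`-th largest eigenvalue, `1 ≤ i ≤ n`, of the signless Laplacian matrix, counted
with multiplicity, where `n` is the number of vertices (`0` for other values of `i`). -/
def signlessLaplacianEigenvalue (G : Graph α β) [Fintype V(G)] [DecidableEq V(G)] (i : ℕ) : ℝ :=
  if h : 1 ≤ i ∧ i ≤ Fintype.card V(G) then
    G.isHermitian_signlessLaplacian.eigenvalues₀ ⟨i - 1, by omega⟩
  else 0

end Graph

end

/-! Suppose `τ(G) < k`. By Nash-Williams–Tutte some partition into `p` classes is crossed by fewer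
than `k(p - 1)` edges, so the cuts of its classes sum to less than `2k(p - 1)`. If at most two
classes had cuts below `2k` and all cuts had at least `k` edges, the sum would be at least `2kp -
2k`. Hence either three classes have cuts below `2k`, or `κ' < k`. In the latter case the two
minimum cuts of the class `𝒢` help: `V₁`, `V₂` and the remaining vertices have cuts of size `κ'`,
`κ'` and at most `2κ' < 2k`.

Either way there are three disjoint sets with cuts below `2k ≤ δ`, and counting degrees shows that
each has at least `l` vertices. The functions constant on each set and zero elsewhere form a
3-dimensional space; the Rayleigh quotient of `Q` on it yields `q₃ ≥ 2δ - 2(3k - 1)/l`. Since `δ ≤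
Δ`, this contradicts the hypothesis.

Nash-Williams–Tutte is proved by linear matroid union: edges become vectors `χ_x - χ_y` over `ℚ`,
spanning trees are bases of their span, and an optimal partial colouring into `k` independent
classes is studied by exchanges. -/

/-! ### Matroid union for vectors: optimal colourings with independent classes. -/

section LinearColoring

open Submodule

variable {K W E ι : Type*} [DivisionRing K] [AddCommGroup W] [Module K W]

/-- A partial colouring of a family of vectors all of whose colour classes are linearly
independent. -/
def IsIndepColoring (K : Type*) {W E ι : Type*} [DivisionRing K] [AddCommGroup W] [Module K W]
    (v : E → W) (c : E → Option ι) : Prop :=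
  ∀ i, LinearIndepOn K v {e | c e = some i}

/-- A partial colouring with independent classes which leaves as few vectors as possible
uncoloured. -/
def IsOptimalColoring (K : Type*) {W E ι : Type*} [DivisionRing K] [AddCommGroup W] [Module K W]
    (v : E → W) (c : E → Option ι) : Prop :=
  IsIndepColoring K v c ∧ ∀ c' : E → Option ι, IsIndepColoring K v c' →
    {e | c e = none}.ncard ≤ {e | c' e = none}.ncard

open Classical in
/-- Two colourings are related by an exchange if the second is obtained from the first by passing
the colour of some vector to an uncoloured one, and both have independent classes. -/
def ColoringExchange (K : Type*) {W E ι : Type*} [DivisionRing K] [AddCommGroup W] [Module K W]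
    (v : E → W) (c c' : E → Option ι) : Prop :=
  IsIndepColoring K v c ∧ IsIndepColoring K v c' ∧
    ∃ x y i, c x = none ∧ c y = some i ∧ c' = c ∘ Equiv.swap x y

theorem ColoringExchange.symm {v : E → W} {c c' : E → Option ι} (h : ColoringExchange K v c c') :
    ColoringExchange K v c' c := by
  classical
  obtain ⟨h₁, h₂, x, y, i, hx, hy, rfl⟩ := h
  refine ⟨h₂, h₁, y, x, i, by simpa using hx, by simpa using hy, ?_⟩
  ext e : 1
  simp [Equiv.swap_comm y x]

theorem setOf_comp_swap_eq_some [DecidableEq E] {c : E → Option ι} {x y : E} {i : ι}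
    (hx : c x = none) (hy : c y = some i) :
    {e | (c ∘ Equiv.swap x y) e = some i} = insert x ({e | c e = some i} \ {y}) := by
  ext e
  have hxy : x ≠ y := by rintro rfl; simp [hx] at hy
  by_cases h1 : e = x
  · subst h1; simp [hy]
  by_cases h2 : e = y
  · subst h2; simp [hx, h1]
  simp [Equiv.swap_apply_of_ne_of_ne h1 h2, h1, h2]

theorem setOf_comp_swap_eq_some_of_ne [DecidableEq E] {c : E → Option ι} {x y : E} {i j : ι}
    (hx : c x = none) (hy : c y = some i) (hj : j ≠ i) :
    {e | (c ∘ Equiv.swap x y) e = some j} = {e | c e = some j} := by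
  ext e
  by_cases h1 : e = x
  · subst h1; simp [hy, hx, hj.symm]
  by_cases h2 : e = y
  · subst h2; simp [hx, hy, hj.symm]
  simp [Equiv.swap_apply_of_ne_of_ne h1 h2]

/-- The transposition maps the new uncoloured vectors injectively to the old ones, so optimality
passes along chains of exchanges. -/
theorem ColoringExchange.isOptimalColoring [Finite E] {v : E → W} {c c' : E → Option ι}
    (h : ColoringExchange K v c c') (hc : IsOptimalColoring K v c) : IsOptimalColoring K v c' := by
  classical
  obtain ⟨h₁, h₂, x, y, i, hx, hy, rfl⟩ := h
  refine ⟨h₂, fun c'' h'' => le_trans ?_ (hc.2 c'' h'')⟩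
  refine Set.ncard_le_ncard_of_injOn (Equiv.swap x y) (fun e he => he)
    (Equiv.injective _).injOn (Set.toFinite _)

/-- An uncoloured vector is in the span of each colour class. -/
theorem IsOptimalColoring.mem_span [Finite E] {v : E → W} {c : E → Option ι}
    (hc : IsOptimalColoring K v c) {x : E} (hx : c x = none) (i : ι) :
    v x ∈ span K (v '' {e | c e = some i}) := by
  classical
  by_contra hn
  -- Otherwise `x` could receive colour `i`, leaving fewer vectors uncoloured.
  have hcl : ∀ j, {e | Function.update c x (some i) e = some j} =
      if j = i then insert x {e | c e = some i} else {e | c e = some j} := by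
    intro j
    ext e
    by_cases he : e = x <;> by_cases hj : j = i <;> simp_all [eq_comm]
  have hind : IsIndepColoring K v (Function.update c x (some i)) := by
    intro j
    rw [hcl j]
    split_ifs with h
    · exact (hc.1 i).insert hn
    · exact hc.1 j
  have hlt : {e | Function.update c x (some i) e = none}.ncard < {e | c e = none}.ncard := by
    refine Set.ncard_lt_ncard ⟨fun e he => ?_, fun hs => ?_⟩ (Set.toFinite _)
    · by_cases hex : e = x <;> simp_all
    · have := hs hx
      simp at this
  exact absurd (hc.2 _ hind) (not_le.2 hlt)

/-- An uncoloured vector is in the span of the vectors which can pass on a given colour to it. -/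
theorem IsOptimalColoring.mem_span_exchange [Finite E] {v : E → W} {c : E → Option ι}
    (hc : IsOptimalColoring K v c) {x : E} (hx : c x = none) (i : ι) :
    v x ∈ span K (v '' {y | c y = some i ∧ ∃ c', ColoringExchange K v c c' ∧ c' y = none}) := by
  classical
  have h := hc.mem_span hx i
  rw [Finsupp.mem_span_image_iff_linearCombination] at h
  obtain ⟨a, ha, hax⟩ := h
  rw [Finsupp.mem_span_image_iff_linearCombination]
  -- The combination of class `i` that equals `v x` works unchanged: every `y` in its support can be
  -- swapped with `x`.
  refine ⟨a, ?_, hax⟩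
  rw [Finsupp.mem_supported] at ha ⊢
  intro y hy
  have hyi : c y = some i := ha hy
  refine ⟨hyi, c ∘ Equiv.swap x y, ⟨hc.1, ?_, x, y, i, hx, hyi, rfl⟩, by simpa using hx⟩
  intro j
  by_cases hj : j = i
  swap
  · rw [setOf_comp_swap_eq_some_of_ne hx hyi hj]
    exact hc.1 j
  subst hj
  rw [setOf_comp_swap_eq_some hx hyi]
  refine ((hc.1 j).mono Set.sdiff_subset).insert fun hmem => ?_
  have hnot := linearIndepOn_iff_notMem_span.1 (hc.1 j) y hyi
  apply hnot
  -- If `v x` were in the span of the class without `y`, solving for `v y`, whose coefficient is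
  -- nonzero, would put `v y` there too.
  have hsplit : a y • v y + (Finsupp.linearCombination K v) (a.erase y) = v x := by
    rw [← hax]
    conv_rhs => rw [← Finsupp.single_add_erase y a]
    rw [map_add, Finsupp.linearCombination_single]
  have herase : (Finsupp.linearCombination K v) (a.erase y) ∈
      span K (v '' ({e | c e = some j} \ {y})) := by
    rw [Finsupp.mem_span_image_iff_linearCombination]
    refine ⟨_, ?_, rfl⟩
    rw [Finsupp.mem_supported, Finsupp.support_erase]
    intro z hz
    simp only [Finset.coe_erase, Set.mem_sdiff, Finset.mem_coe] at hz
    exact ⟨ha hz.1, hz.2⟩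
  have hay : a y ≠ 0 := Finsupp.mem_support_iff.1 hy
  rw [← smul_mem_iff _ hay, eq_sub_of_add_eq hsplit]
  exact sub_mem hmem herase

/-- An optimal colouring has a set `A` containing all uncoloured vectors and spanned by its part in
each of the colour classes. -/
theorem IsOptimalColoring.exists_set_span [Finite E] {v : E → W} {c : E → Option ι}
    (hc : IsOptimalColoring K v c) :
    ∃ A : Set E, (∀ e, c e = none → e ∈ A) ∧
      ∀ i, span K (v '' ({e | c e = some i} ∩ A)) = span K (v '' A) := by
  classical
  let R := Relation.ReflTransGen (ColoringExchange K v) c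
  -- The vectors left uncoloured by some colouring reachable from `c` by exchanges.
  let A : Set E := {x | ∃ c', R c' ∧ c' x = none}
  have hopt : ∀ c', R c' → IsOptimalColoring K v c' := by
    intro c' h
    induction h with
    | refl => exact hc
    | tail _ h ih => exact h.isOptimalColoring ih
  -- The only vector that can enter a class is `x`; it is uncoloured in `c₁`, hence already spanned
  -- by vectors of that class that can be exchanged with it, all in `A`. By symmetry, exchanges
  -- preserve the span of each class within `A`.
  have hle : ∀ c₁ c₂, R c₁ → R c₂ → ColoringExchange K v c₁ c₂ → ∀ i,
      span K (v '' ({e | c₂ e = some i} ∩ A)) ≤ span K (v '' ({e | c₁ e = some i} ∩ A)) := by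
    intro c₁ c₂ h₁ h₂ h i
    have hex : ∀ x, c₁ x = none → v x ∈ span K (v '' ({e | c₁ e = some i} ∩ A)) := by
      intro x hx
      refine span_mono (Set.image_mono ?_) ((hopt _ h₁).mem_span_exchange hx i)
      rintro y ⟨hy, c', hc', hy'⟩
      exact ⟨hy, c', h₁.tail hc', hy'⟩
    obtain ⟨-, -, x, y, j, hx, hy, rfl⟩ := h
    rw [span_le]
    rintro _ ⟨z, ⟨hz, hzA⟩, rfl⟩
    by_cases hzx : z = x
    · subst hzx; exact hex z hx
    by_cases hzy : z = y
    · subst hzy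
      simp [hx] at hz
    refine subset_span ⟨z, ⟨?_, hzA⟩, rfl⟩
    simpa [Equiv.swap_apply_of_ne_of_ne hzx hzy] using hz
  have heq : ∀ c', R c' → ∀ i, span K (v '' ({e | c' e = some i} ∩ A)) =
      span K (v '' ({e | c e = some i} ∩ A)) := by
    intro c' h
    induction h with
    | refl => intro i; rfl
    | tail h₁ h ih =>
      intro i
      rw [← ih i]
      exact le_antisymm (hle _ _ h₁ (h₁.tail h) h i) (hle _ _ (h₁.tail h) h₁ h.symm i)
  refine ⟨A, fun e he => ⟨c, .refl, he⟩, fun i => le_antisymm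
    (span_mono (Set.image_mono Set.inter_subset_right)) ?_⟩
  rw [span_le]
  rintro _ ⟨x, ⟨c', h', hx⟩, rfl⟩
  have := (hopt c' h').mem_span_exchange hx i
  rw [SetLike.mem_coe, ← heq c' h' i]
  refine span_mono (Set.image_mono ?_) this
  rintro y ⟨hy, c'', hc'', hy'⟩
  exact ⟨hy, c'', h'.tail hc'', hy'⟩

theorem exists_isOptimalColoring [Finite E] (v : E → W) :
    ∃ c : E → Option ι, IsOptimalColoring K v c := by
  let S : Set (E → Option ι) := {c | IsIndepColoring K v c}
  have hS : S.Nonempty := ⟨fun _ => none, fun i => by simp⟩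
  let f : (E → Option ι) → ℕ := fun c => {e | c e = none}.ncard
  refine ⟨Function.argminOn f S hS, Function.argminOn_mem f S hS, fun c' h' => ?_⟩
  exact Function.argminOn_le f S h'

end LinearColoring

/-! ### Difference vectors of edges and the packing count. -/

section IncidenceVector

open Submodule

variable {V E : Type*} [DecidableEq V]

/-- The vector `χ_x - χ_y`. -/
def diffVec (x y : V) : V → ℚ := Pi.single x 1 - Pi.single y 1

theorem diffVec_self (x : V) : diffVec x x = 0 := sub_self _

theorem diffVec_add (x y z : V) : diffVec x y + diffVec y z = diffVec x z := by
  simp [diffVec]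

theorem neg_diffVec (x y : V) : -diffVec x y = diffVec y x := by
  simp [diffVec]

/-- Two vertices are related if their difference vector lies in a given subspace. -/
def diffSetoid (S : Submodule ℚ (V → ℚ)) : Setoid V where
  r x y := diffVec x y ∈ S
  iseqv :=
    { refl x := by rw [diffVec_self]; exact zero_mem S
      symm {x y} h := by rw [← neg_diffVec]; exact neg_mem h
      trans {x y z} h h' := by rw [← diffVec_add x y z]; exact add_mem h h' }

/-- Modulo `S`, the unit vector of a vertex depends only on its class, so the codimension of `S` is
at most the number of classes. -/
theorem card_le_finrank_add_card_quotient [Fintype V] (S : Submodule ℚ (V → ℚ)) :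
    Nat.card V ≤ Module.finrank ℚ S + Nat.card (Quotient (diffSetoid S)) := by
  have h1 := S.finrank_quotient_add_finrank
  rw [Module.finrank_fintype_fun_eq_card, ← Nat.card_eq_fintype_card] at h1
  have : Finite (Quotient (diffSetoid S)) := inferInstance
  let g : Quotient (diffSetoid S) → (V → ℚ) ⧸ S :=
    Quotient.lift (fun x => S.mkQ (Pi.single x 1)) fun x y h => by
      have h : diffVec x y ∈ S := h
      simpa [diffVec, Submodule.Quotient.eq] using h
  have hspan : span ℚ (Set.range g) = ⊤ := by
    rw [eq_top_iff, ← S.range_mkQ, LinearMap.range_eq_map, ← (Pi.basisFun ℚ V).span_eq, map_span,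
      span_le]
    rintro _ ⟨_, ⟨x, rfl⟩, rfl⟩
    refine subset_span ⟨⟦x⟧, ?_⟩
    simp only [Pi.basisFun_apply]
    rfl
  have h2 : Module.finrank ℚ ((V → ℚ) ⧸ S) ≤ Nat.card (Quotient (diffSetoid S)) := by
    have := Fintype.ofFinite (Quotient (diffSetoid S))
    rw [← finrank_top, ← hspan, Nat.card_eq_fintype_card]
    exact finrank_range_le_card g
  omega

theorem LinearIndepOn.finrank_span_image {K W : Type*} [DivisionRing K] [AddCommGroup W]
    [Module K W] [Finite E] {v : E → W} {I : Set E} (hI : LinearIndepOn K v I) :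
    Module.finrank K (span K (v '' I)) = I.ncard := by
  have := Fintype.ofFinite I
  rw [Set.image_eq_range, finrank_span_eq_card hI.linearIndependent, ← Nat.card_eq_fintype_card,
    Nat.card_coe_set_eq]

/-- There are fewer than `|V|` linearly independent difference vectors. -/
theorem ncard_lt_card_of_linearIndepOn [Fintype V] [Nonempty V] [Finite E] (s t : E → V)
    {I : Set E} (hI : LinearIndepOn ℚ (fun e => diffVec (s e) (t e)) I) :
    I.ncard + 1 ≤ Nat.card V := by
  -- Difference vectors lie in the hyperplane of coordinate sum zero.
  let σ : (V → ℚ) →ₗ[ℚ] ℚ := ∑ x, LinearMap.proj x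
  have hσ : ∀ x : V, σ (Pi.single x 1) = 1 := by
    intro x
    simp [σ, LinearMap.sum_apply]
  have hle : span ℚ ((fun e => diffVec (s e) (t e)) '' I) ≤ LinearMap.ker σ := by
    rw [span_le]
    rintro _ ⟨e, -, rfl⟩
    simp [diffVec, hσ]
  have hlt : LinearMap.ker σ < ⊤ := by
    rw [lt_top_iff_ne_top]
    intro h
    have : (Pi.single (Classical.arbitrary V) 1 : V → ℚ) ∈ LinearMap.ker σ := h ▸ mem_top
    simp [hσ] at this
  have h1 := hI.finrank_span_image
  have h2 := (Submodule.finrank_mono hle).trans_lt (Submodule.finrank_lt hlt.ne)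
  rw [Module.finrank_fintype_fun_eq_card, ← Nat.card_eq_fintype_card] at h2
  omega

/-- If every partition of `V` into `p` classes is crossed by at least `k (p - 1)` edges, then there
are `k` disjoint sets of `|V| - 1` edges with linearly independent difference vectors. -/
theorem exists_isIndepColoring_ncard [Finite V] [Nonempty V] [Finite E] (s t : E → V) (k : ℕ)
    (h : ∀ r : Setoid V, k * (Nat.card (Quotient r) - 1) ≤ {e | ¬ r (s e) (t e)}.ncard) :
    ∃ c : E → Option (Fin k), IsIndepColoring ℚ (fun e => diffVec (s e) (t e)) c ∧
      ∀ i, {e | c e = some i}.ncard + 1 = Nat.card V := by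
  have := Fintype.ofFinite V
  set v : E → V → ℚ := fun e => diffVec (s e) (t e)
  obtain ⟨c, hc⟩ := exists_isOptimalColoring (K := ℚ) (ι := Fin k) v
  obtain ⟨A, hA, hspan⟩ := hc.exists_set_span
  set S := span ℚ (v '' A)
  have hd : ∀ i, ({e | c e = some i} ∩ A).ncard = Module.finrank ℚ S := by
    intro i
    rw [← hspan i, ((hc.1 i).mono Set.inter_subset_left).finrank_span_image]
  have hcard := card_le_finrank_add_card_quotient S
  have hcross := h (diffSetoid S)
  -- Edges in `A` join equivalent vertices, so crossing edges lie outside `A` and are coloured.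
  have hsub : {e | ¬ diffSetoid S (s e) (t e)} ⊆ ⋃ i, {e | c e = some i} \ A := by
    intro e he
    have heA : e ∉ A := fun heA => he (subset_span ⟨e, heA, rfl⟩)
    obtain ⟨i, hi⟩ := Option.ne_none_iff_exists'.1 fun hn => heA (hA e hn)
    exact Set.mem_iUnion.2 ⟨i, hi, heA⟩
  have hsum : k * (Nat.card (Quotient (diffSetoid S)) - 1) ≤
      ∑ i, ({e | c e = some i} \ A).ncard :=
    hcross.trans ((Set.ncard_le_ncard hsub (Set.toFinite _)).trans
      (Set.ncard_iUnion_le_of_fintype _))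
  have hsplit : ∀ i, ({e | c e = some i} ∩ A).ncard + ({e | c e = some i} \ A).ncard =
      {e | c e = some i}.ncard :=
    fun i => Set.ncard_inter_add_ncard_sdiff_eq_ncard _ _ (Set.toFinite _)
  have hub : ∀ i, {e | c e = some i}.ncard + 1 ≤ Nat.card V := fun i =>
    ncard_lt_card_of_linearIndepOn s t (hc.1 i)
  refine ⟨c, hc.1, fun i => le_antisymm (hub i) ?_⟩
  -- Outside `A` each class has at most `|V| - 1 - dim S ≤ p - 1` edges, and a class that is too
  -- small has strictly fewer. Summing gives fewer than `k (p - 1)` crossing edges.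
  by_contra! hlt
  have : ∑ i, ({e | c e = some i} \ A).ncard <
      ∑ _i : Fin k, (Nat.card (Quotient (diffSetoid S)) - 1) := by
    refine Finset.sum_lt_sum (fun j _ => ?_) ⟨i, Finset.mem_univ _, ?_⟩
    · have := hub j
      have := hsplit j
      have := hd j
      omega
    · have := hsplit i
      have := hd i
      omega
  simp only [Finset.sum_const, Finset.card_univ, Fintype.card_fin, smul_eq_mul] at this
  omega

/-- A function on the vertices which is constant along `|V| - 1` edges with linearly independent
difference vectors is constant. -/
theorem eq_of_linearIndepOn_of_ncard [Finite V] [Finite E] {s t : E → V}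
    {I : Set E} (hI : LinearIndepOn ℚ (fun e => diffVec (s e) (t e)) I)
    (hcard : I.ncard + 1 = Nat.card V) {X : Type*} (f : V → X) (hf : ∀ e ∈ I, f (s e) = f (t e))
    (x y : V) : f x = f y := by
  classical
  have := Fintype.ofFinite V
  have : Nonempty V := ⟨x⟩
  -- Pairing with the indicator of the level set of `f` through `x` kills all edges of `I` but not
  -- `diffVec x y`.
  let τ : (V → ℚ) →ₗ[ℚ] ℚ := ∑ z, if f z = f x then LinearMap.proj z else 0
  have hτ : ∀ z : V, τ (Pi.single z 1) = if f z = f x then 1 else 0 := by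
    intro z
    simp only [τ, LinearMap.sum_apply]
    rw [Finset.sum_eq_single z]
    · split_ifs <;> simp
    · intro b _ hb
      split_ifs <;> simp [hb]
    · simp
  by_contra hne
  have hle : span ℚ ((fun e => diffVec (s e) (t e)) '' I) ≤ LinearMap.ker τ := by
    rw [span_le]
    rintro _ ⟨e, he, rfl⟩
    simp [diffVec, hτ, hf e he]
  have hnot : diffVec x y ∉ span ℚ ((fun e => diffVec (s e) (t e)) '' I) := by
    intro h
    have := hle h
    simp [diffVec, hτ, Ne.symm hne] at this
  -- An extra edge `none` from `x` to `y` would give `|V|` independent difference vectors.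
  have h2 : LinearIndepOn ℚ (fun o : Option E => diffVec (o.elim x s) (o.elim y t))
      (insert none (some '' I)) := by
    refine LinearIndepOn.insert ?_ ?_
    · exact LinearIndepOn.image_of_comp some _ hI
    · rw [Set.image_image]
      exact hnot
  have h3 :=
    ncard_lt_card_of_linearIndepOn (fun o : Option E => o.elim x s) (fun o => o.elim y t) h2
  rw [Set.ncard_insert_of_notMem (by simp) (Set.toFinite _),
    Set.ncard_image_of_injective _ (Option.some_injective E)] at h3
  omega

end IncidenceVector

/-! ### From independent edge sets to spanning trees. -/

namespace Graph

variable {α β : Type*} {G : Graph α β}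

theorem exists_orientation (G : Graph α β) :
    ∃ s t : E(G) → V(G), ∀ e : E(G), G.IsLink e (s e) (t e) := by
  choose x y h using fun e : E(G) => G.exists_isLink_of_mem_edgeSet e.2
  exact ⟨fun e => ⟨x e, (h e).left_mem⟩, fun e => ⟨y e, (h e).right_mem⟩, h⟩

theorem isLink_iff_of_orientation {s t : E(G) → V(G)} (hst : ∀ e : E(G), G.IsLink e (s e) (t e))
    (e : E(G)) (x y : V(G)) : G.IsLink e x y ↔ s e = x ∧ t e = y ∨ s e = y ∧ t e = x := by
  rw [(hst e).isLink_iff]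
  simp only [Subtype.ext_iff]

/-- A loopless graph whose edges have linearly independent difference vectors, and which has one
edge less than vertices, is a spanning tree of any graph which contains it. -/
theorem isSpanningTreeOf_restrict [G.Loopless] [Finite V(G)] [Nonempty V(G)] [DecidableEq V(G)]
    [Finite E(G)] {s t : E(G) → V(G)} (hst : ∀ e : E(G), G.IsLink e (s e) (t e)) {I : Set E(G)}
    (hI : LinearIndepOn ℚ (fun e => diffVec (s e) (t e)) I) (hcard : I.ncard + 1 = Nat.card V(G)) :
    (G.restrict (Subtype.val '' I)).IsSpanningTreeOf G := by
  have hends : ∀ (e : E(G)) (x y : V(G)), G.IsLink e x y →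
      s e = x ∧ t e = y ∨ s e = y ∧ t e = x :=
    fun e x y => (isLink_iff_of_orientation hst e x y).1
  refine ⟨⟨restrict_le, rfl⟩, ⟨?_, ?_⟩⟩
  · have hloop : (G.restrict (Subtype.val '' I)).Loopless := Loopless.anti restrict_le
    refine { eq_of_isLink := ?_ }
    rintro _ _ x y ⟨⟨e, he, rfl⟩, hexy⟩ ⟨⟨f, hf, rfl⟩, hfxy⟩
    by_contra hne
    -- Parallel edges have equal or opposite difference vectors, so they are dependent.
    have hfe : f ∈ I \ {e} := ⟨hf, fun h => hne (by rw [Set.mem_singleton_iff.1 h])⟩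
    apply linearIndepOn_iff_notMem_span.1 hI e he
    have hmem := Submodule.subset_span (R := ℚ)
      (Set.mem_image_of_mem (fun e => diffVec (s e) (t e)) hfe)
    rcases hends e ⟨x, hexy.left_mem⟩ ⟨y, hexy.right_mem⟩ hexy with ⟨h1, h2⟩ | ⟨h1, h2⟩ <;>
      rcases hends f ⟨x, hexy.left_mem⟩ ⟨y, hexy.right_mem⟩ hfxy with ⟨h3, h4⟩ | ⟨h3, h4⟩ <;>
      simp only [h1, h2, h3, h4, SetLike.mem_coe] at hmem ⊢
    · exact hmem
    · rw [← neg_diffVec]; exact neg_mem hmem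
    · rw [← neg_diffVec]; exact neg_mem hmem
    · exact hmem
  · have hfin : Finite V(G.restrict (Subtype.val '' I)) := inferInstanceAs (Finite V(G))
    set H : SimpleGraph V(G) := (G.restrict (Subtype.val '' I)).toSimpleGraph
    change H.IsTree
    have hadj : ∀ e ∈ I, H.Adj (s e) (t e) := fun e he =>
      ⟨fun h => (hst e).ne (congrArg Subtype.val h), e, ⟨e, he, rfl⟩, hst e⟩
    have hconn : H.Connected := by
      refine ⟨fun x y => ?_⟩
      rw [← SimpleGraph.ConnectedComponent.eq]
      exact eq_of_linearIndepOn_of_ncard hI hcard H.connectedComponentMk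
        (fun e he => SimpleGraph.ConnectedComponent.eq.2 (hadj e he).reachable) x y
    rw [SimpleGraph.isTree_iff_connected_and_card]
    refine ⟨hconn, le_antisymm ?_ hconn.card_vert_le_card_edgeSet_add_one⟩
    rw [← hcard, Nat.card_coe_set_eq]
    have hsub : H.edgeSet ⊆ (fun e => s(s e, t e)) '' I := by
      intro z
      induction z with | _ x y
      rintro ⟨-, _, ⟨e, he, rfl⟩, hl⟩
      refine ⟨e, he, ?_⟩
      rcases hends e x y hl with ⟨h1, h2⟩ | ⟨h1, h2⟩
      · simp [h1, h2]
      · simp [h1, h2, Sym2.eq_swap]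
    exact Nat.add_le_add_right ((Set.ncard_le_ncard hsub (Set.toFinite _)).trans
      (Set.ncard_image_le (Set.toFinite _))) 1

/-- **The tree packing theorem of Nash-Williams and Tutte**: if every partition of the vertex set
into `p` classes is crossed by at least `k (p - 1)` edges, there are `k` edge-disjoint spanning
trees. -/
theorem le_treePackingNumber_of_forall_setoid [G.Loopless] [Finite V(G)] [Nonempty V(G)]
    [Finite E(G)] (k : ℕ)
    (h : ∀ r : Setoid V(G), k * (Nat.card (Quotient r) - 1) ≤
      {e | ∃ x y : V(G), G.IsLink e x y ∧ ¬ r x y}.ncard) :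
    (k : ℕ∞) ≤ G.treePackingNumber := by
  classical
  obtain ⟨s, t, hst⟩ := G.exists_orientation
  have hcross : ∀ r : Setoid V(G), k * (Nat.card (Quotient r) - 1) ≤
      {e | ¬ r (s e) (t e)}.ncard := by
    intro r
    refine (h r).trans ?_
    rw [← Set.ncard_image_of_injective {e : E(G) | ¬ r (s e) (t e)} Subtype.val_injective]
    refine Set.ncard_le_ncard ?_ (Set.toFinite _)
    rintro e ⟨x, y, hl, hr⟩
    refine ⟨⟨e, hl.edge_mem⟩, fun hrst => hr ?_, rfl⟩
    rcases (isLink_iff_of_orientation hst ⟨e, hl.edge_mem⟩ x y).1 hl with ⟨h1, h2⟩ | ⟨h1, h2⟩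
    · rwa [h1, h2] at hrst
    · rw [h1, h2] at hrst
      exact r.symm hrst
  obtain ⟨c, hc, hcard⟩ := exists_isIndepColoring_ncard s t k hcross
  refine le_iSup₂_of_le k ⟨fun i => G.restrict (Subtype.val '' {e | c e = some i}),
    fun i => isSpanningTreeOf_restrict hst (hc i) (hcard i), fun i j hij => ?_⟩ le_rfl
  refine Set.disjoint_left.2 ?_
  rintro _ ⟨-, e, he, rfl⟩ ⟨-, f, hf, hfe⟩
  rw [Subtype.ext hfe] at hf
  exact hij (Option.some_injective _ (he.symm.trans hf))

end Graph

/-! ### A lower bound for eigenvalues. -/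

/-- The easy half of the Courant–Fischer principle: an eigenvalue is bounded below by the values of
the Rayleigh quotient on a subspace of the appropriate dimension. -/
theorem LinearMap.IsSymmetric.le_eigenvalues {F : Type*} [NormedAddCommGroup F]
    [InnerProductSpace ℝ F] [FiniteDimensional ℝ F] {T : F →ₗ[ℝ] F} (hT : T.IsSymmetric) {n : ℕ}
    (hn : Module.finrank ℝ F = n) (i : Fin n) (f : (Fin (i + 1) → ℝ) →ₗ[ℝ] F)
    (hf : Function.Injective f) {c : ℝ} (h : ∀ a, c * ‖f a‖ ^ 2 ≤ inner ℝ (f a) (T (f a))) :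
    c ≤ hT.eigenvalues hn i := by
  set b := hT.eigenvectorBasis hn
  -- Only `i` linear conditions on `i + 1` parameters: some nonzero `a` makes `f a` orthogonal to
  -- the first `i` eigenvectors, leaving eigenvalues at most the one at `i`.
  let φ : (Fin (i + 1) → ℝ) →ₗ[ℝ] (Fin i → ℝ) :=
    LinearMap.pi fun j => (innerₛₗ ℝ (b ⟨j, j.2.trans i.2⟩)).comp f
  obtain ⟨a, ha, ha0⟩ := (Submodule.ne_bot_iff _).1
    (LinearMap.ker_ne_bot_of_finrank_lt (f := φ) (by simp))
  have horth : ∀ j : Fin n, j < i → inner ℝ (b j) (f a) = 0 := by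
    intro j hj
    have := congrFun (LinearMap.mem_ker.1 ha) ⟨j, hj⟩
    simpa [φ] using this
  have hfa : f a ≠ 0 := fun h0 => ha0 (hf (by rw [h0, map_zero]))
  have hnorm : ‖f a‖ ^ 2 = ∑ j, inner ℝ (b j) (f a) ^ 2 := by
    rw [← b.sum_sq_norm_inner_right (f a)]
    simp
  have hinner : inner ℝ (f a) (T (f a)) = ∑ j, hT.eigenvalues hn j * inner ℝ (b j) (f a) ^ 2 := by
    rw [← b.sum_inner_mul_inner]
    refine Finset.sum_congr rfl fun j _ => ?_
    rw [← hT (b j) (f a), hT.apply_eigenvectorBasis hn j]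
    simp only [b, inner_smul_left, real_inner_comm]
    simp
    ring
  have hle : inner ℝ (f a) (T (f a)) ≤ hT.eigenvalues hn i * ‖f a‖ ^ 2 := by
    rw [hinner, hnorm, Finset.mul_sum]
    refine Finset.sum_le_sum fun j _ => ?_
    rcases lt_or_ge j i with hj | hj
    · simp [horth j hj]
    · exact mul_le_mul_of_nonneg_right (hT.eigenvalues_antitone hn hj) (sq_nonneg _)
  exact le_of_mul_le_mul_right ((h a).trans hle) (by positivity)

/-! ### Counting edges, degrees and cuts. -/

namespace Graph

variable {α β : Type*} {G : Graph α β}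

open Classical in
theorem ncard_eq_sum_of_subset_edgeSet [Fintype E(G)] {S : Set β} (hS : S ⊆ E(G)) :
    S.ncard = ∑ e : E(G), if (e : β) ∈ S then 1 else 0 := by
  rw [Finset.sum_boole, Nat.cast_id, ← Set.ncard_coe_finset,
    ← Set.ncard_image_of_injective _ Subtype.val_injective]
  congr 1
  ext e
  simpa using fun he => hS he

open Classical in
theorem numLinks_eq_sum [Fintype E(G)] [G.Loopless] {s t : E(G) → V(G)}
    (hst : ∀ e : E(G), G.IsLink e (s e) (t e)) (u v : V(G)) :
    G.numLinks u v = ∑ e, ((if s e = u ∧ t e = v then 1 else 0) +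
      if t e = u ∧ s e = v then 1 else 0) := by
  rw [numLinks, ncard_eq_sum_of_subset_edgeSet (fun e he => he.edge_mem)]
  refine Finset.sum_congr rfl fun e _ => ?_
  simp only [Set.mem_ofPred_eq, isLink_iff_of_orientation hst]
  have hne : s e ≠ t e := fun h => (hst e).ne (congrArg Subtype.val h)
  by_cases h1 : s e = u ∧ t e = v
  · obtain ⟨rfl, rfl⟩ := h1
    simp [hne.symm]
  · simp [h1, and_comm]

/-- Each edge is seen once from either end. The formulas for degrees, cuts and crossing edges come
from choices of `F`. -/
theorem sum_numLinks_mul [Fintype V(G)] [Fintype E(G)] [G.Loopless] {s t : E(G) → V(G)}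
    (hst : ∀ e : E(G), G.IsLink e (s e) (t e)) (F : V(G) → V(G) → ℕ) :
    ∑ u : V(G), ∑ v : V(G), G.numLinks u v * F u v = ∑ e, (F (s e) (t e) + F (t e) (s e)) := by
  classical
  simp only [numLinks_eq_sum hst, Finset.sum_mul, add_mul]
  simp only [Finset.sum_comm (t := (Finset.univ : Finset E(G)))]
  refine Finset.sum_congr rfl fun e _ => ?_
  simp [Finset.sum_add_distrib, ite_and]

theorem numLinks_comm (G : Graph α β) (u v : α) : G.numLinks u v = G.numLinks v u := by
  simp only [numLinks, G.isLink_comm]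

theorem numLinks_self (G : Graph α β) [G.Loopless] (u : α) : G.numLinks u u = 0 := by
  simp [numLinks, isLink_self_iff]

theorem vertexDegree_eq_sum [Fintype V(G)] [Finite E(G)] [G.Loopless] (u : V(G)) :
    G.vertexDegree u = ∑ v : V(G), G.numLinks u v := by
  classical
  have := Fintype.ofFinite E(G)
  obtain ⟨s, t, hst⟩ := G.exists_orientation
  have h := sum_numLinks_mul hst fun x _ => if x = u then 1 else 0
  rw [Finset.sum_eq_single u (by simp +contextual) (by simp)] at h
  simp only [if_true, mul_one] at h
  rw [h, vertexDegree, ncard_eq_sum_of_subset_edgeSet (fun e he => he.edge_mem)]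
  refine Finset.sum_congr rfl fun e _ => ?_
  have hne : s e ≠ t e := fun h => (hst e).ne (congrArg Subtype.val h)
  have hinc : G.Inc e u ↔ s e = u ∨ t e = u := by
    constructor
    · rintro ⟨y, hy⟩
      rcases (isLink_iff_of_orientation hst e u ⟨y, hy.right_mem⟩).1 hy with h | h
      · exact .inl h.1
      · exact .inr h.2
    · rintro (rfl | rfl)
      · exact (hst e).inc_left
      · exact (hst e).inc_right
  simp only [Set.mem_ofPred_eq, hinc]
  by_cases h1 : s e = u
  · subst h1
    simp [hne.symm]
  · simp [h1]

open Classical in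
theorem numEdgesBetween_compl_eq_sum [Fintype V(G)] [Finite E(G)] [G.Loopless] (S : Set α) :
    G.numEdgesBetween S (V(G) \ S) =
      ∑ u : V(G), ∑ v : V(G), G.numLinks u v * if (u : α) ∈ S ∧ (v : α) ∉ S then 1 else 0 := by
  have := Fintype.ofFinite E(G)
  obtain ⟨s, t, hst⟩ := G.exists_orientation
  rw [sum_numLinks_mul hst fun u v => if (u : α) ∈ S ∧ (v : α) ∉ S then 1 else 0, numEdgesBetween,
    ncard_eq_sum_of_subset_edgeSet (by rintro e ⟨x, -, y, -, h⟩; exact h.edge_mem)]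
  refine Finset.sum_congr rfl fun e _ => ?_
  have h : (e : β) ∈ {e | ∃ x ∈ S, ∃ y ∈ V(G) \ S, G.IsLink e x y} ↔
      ((s e : α) ∈ S ∧ (t e : α) ∉ S) ∨ ((t e : α) ∈ S ∧ (s e : α) ∉ S) := by
    constructor
    · rintro ⟨x, hx, y, hy, hl⟩
      rcases (hst e).eq_and_eq_or_eq_and_eq hl with ⟨h1, h2⟩ | ⟨h1, h2⟩
      · exact .inl ⟨h1 ▸ hx, h2 ▸ hy.2⟩
      · exact .inr ⟨h2 ▸ hx, h1 ▸ hy.2⟩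
    · rintro (⟨h1, h2⟩ | ⟨h1, h2⟩)
      · exact ⟨_, h1, _, ⟨(t e).2, h2⟩, hst e⟩
      · exact ⟨_, h1, _, ⟨(s e).2, h2⟩, (hst e).symm⟩
  simp only [h]
  by_cases h1 : (s e : α) ∈ S <;> by_cases h2 : (t e : α) ∈ S <;> simp [h1, h2]

open Classical in
theorem two_mul_ncard_crossing [Fintype V(G)] [Finite E(G)] [G.Loopless] (r : Setoid V(G)) :
    2 * {e | ∃ x y : V(G), G.IsLink e x y ∧ ¬ r x y}.ncard =
      ∑ u : V(G), ∑ v : V(G), G.numLinks u v * if r u v then 0 else 1 := by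
  have := Fintype.ofFinite E(G)
  obtain ⟨s, t, hst⟩ := G.exists_orientation
  rw [sum_numLinks_mul hst fun u v => if r u v then 0 else 1,
    ncard_eq_sum_of_subset_edgeSet (by rintro e ⟨x, y, h, -⟩; exact h.edge_mem), Finset.mul_sum]
  refine Finset.sum_congr rfl fun e _ => ?_
  have h : (e : β) ∈ {e | ∃ x y : V(G), G.IsLink e x y ∧ ¬ r x y} ↔ ¬ r (s e) (t e) := by
    constructor
    · rintro ⟨x, y, hl, hr⟩
      rcases (isLink_iff_of_orientation hst e x y).1 hl with ⟨h1, h2⟩ | ⟨h1, h2⟩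
      · rwa [h1, h2]
      · rw [h1, h2]
        exact fun h => hr (r.symm h)
    · exact fun h => ⟨_, _, hst e, h⟩
  have h' : r (t e) (s e) ↔ r (s e) (t e) := ⟨r.symm, r.symm⟩
  simp only [h, h']
  by_cases hr : r (s e) (t e) <;> simp [hr]

theorem minDegree_le_vertexDegree (G : Graph α β) (v : V(G)) : G.minDegree ≤ G.vertexDegree v :=
  ciInf_le (OrderBot.bddBelow _) v

theorem vertexDegree_le_maxDegree [Finite V(G)] (v : V(G)) : G.vertexDegree v ≤ G.maxDegree :=
  le_ciSup (f := fun v : V(G) => G.vertexDegree v) (Set.finite_range _).bddAbove v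

theorem numLinks_le_multiplicity [Finite V(G)] (u v : V(G)) : G.numLinks u v ≤ G.multiplicity :=
  le_ciSup (f := fun p : V(G) × V(G) => G.numLinks p.1 p.2) (Set.finite_range _).bddAbove (u, v)

theorem edgeConnectivity_le {S : Set α} (hS : S.Nonempty) (hS' : S ⊂ V(G)) :
    G.edgeConnectivity ≤ G.numEdgesBetween S (V(G) \ S) :=
  Nat.sInf_le ⟨S, hS, hS', rfl⟩

/-- A set of vertices with fewer than `δ` outgoing edges has more than `δ / m` elements. -/
theorem minDegree_lt_ncard_mul_multiplicity [Finite V(G)] [Finite E(G)] [G.Loopless] {S : Set α}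
    (hS : S ⊆ V(G)) (hne : S.Nonempty)
    (hlt : G.numEdgesBetween S (V(G) \ S) < G.minDegree) :
    G.minDegree < S.ncard * G.multiplicity := by
  classical
  have := Fintype.ofFinite V(G)
  by_contra! hle
  set P : Finset V(G) := Finset.univ.filter fun u => (u : α) ∈ S with hP
  have hcard : P.card = S.ncard := by
    rw [← Set.ncard_coe_finset, ← Set.ncard_image_of_injective _ Subtype.val_injective]
    congr 1
    ext x
    simpa [hP] using fun hx => hS hx
  have hpos : 0 < P.card := by
    rw [hcard]
    exact (Set.ncard_pos ((Set.toFinite V(G)).subset hS)).2 hne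
  have hout : G.numEdgesBetween S (V(G) \ S) = ∑ u ∈ P, ∑ v ∈ Pᶜ, G.numLinks u v := by
    rw [numEdgesBetween_compl_eq_sum]
    simp only [hP, Finset.sum_filter, Finset.compl_filter, ite_and, mul_ite, mul_one, mul_zero]
    refine Finset.sum_congr rfl fun u _ => ?_
    split_ifs <;> simp
  have hin : ∀ u ∈ P, ∑ v ∈ P, G.numLinks u v ≤ (P.card - 1) * G.multiplicity := by
    intro u hu
    rw [← Finset.add_sum_erase _ _ hu, numLinks_self, zero_add, ← Finset.card_erase_of_mem hu,
      ← smul_eq_mul, ← Finset.sum_const]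
    exact Finset.sum_le_sum fun v _ => numLinks_le_multiplicity u v
  have h1 : P.card * G.minDegree ≤ P.card * ((P.card - 1) * G.multiplicity) +
      G.numEdgesBetween S (V(G) \ S) := by
    rw [hout, ← smul_eq_mul, ← smul_eq_mul, ← Finset.sum_const, ← Finset.sum_const,
      ← Finset.sum_add_distrib]
    refine Finset.sum_le_sum fun u hu => (G.minDegree_le_vertexDegree u).trans ?_
    rw [vertexDegree_eq_sum, ← Finset.sum_add_sum_compl P]
    exact Nat.add_le_add_right (hin u hu) _
  obtain ⟨n, hn⟩ := Nat.exists_eq_succ_of_ne_zero hpos.ne'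
  rw [← hcard, hn] at hle
  rw [hn] at h1
  simp only [Nat.succ_eq_add_one, Nat.add_sub_cancel] at h1 hle
  -- With `|S| = n + 1` and `(n + 1) m ≤ δ`, inner edges account for at most `nδ` of a degree sum of
  -- at least `(n + 1)δ`, so at least `δ` edges leave `S`.
  have h2 : n * ((n + 1) * G.multiplicity) ≤ n * G.minDegree := Nat.mul_le_mul_left n hle
  nlinarith

/-- A set of vertices with fewer than `δ` outgoing edges is not a single vertex. -/
theorem one_lt_ncard_of_numEdgesBetween_lt_minDegree [Finite V(G)] [Finite E(G)] [G.Loopless]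
    {S : Set α} (hS : S ⊆ V(G)) (hne : S.Nonempty)
    (hlt : G.numEdgesBetween S (V(G) \ S) < G.minDegree) : 1 < S.ncard := by
  have hpos := (Set.ncard_pos ((Set.toFinite V(G)).subset hS)).2 hne
  by_contra! h
  obtain ⟨x, rfl⟩ := Set.ncard_eq_one.1 (le_antisymm h hpos)
  refine hlt.not_ge ((G.minDegree_le_vertexDegree ⟨x, hS rfl⟩).trans ?_)
  refine Set.ncard_le_ncard ?_ ((Set.toFinite E(G)).subset ?_)
  · rintro e ⟨y, hy⟩
    exact ⟨x, rfl, y, ⟨hy.right_mem, hy.ne.symm⟩, hy⟩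
  · rintro e ⟨x, -, y, -, hl⟩
    exact hl.edge_mem

/-! ### The spectral bound from three disjoint sets. -/

/-- The third largest signless Laplacian eigenvalue is bounded below in terms of the number of edges
leaving three disjoint sets of vertices. -/
theorem le_signlessLaplacianEigenvalue_three [Fintype V(G)] [DecidableEq V(G)]
    [Finite E(G)] [G.Loopless] (U : Fin 3 → Set α) (hU : ∀ i, U i ⊆ V(G))
    (hne : ∀ i, (U i).Nonempty) (hdisj : Pairwise fun i j => Disjoint (U i) (U j)) {D l : ℝ}
    (hl : 0 < l) (hlU : ∀ i, l ≤ (U i).ncard)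
    (hD : ∀ i, (G.numEdgesBetween (U i) (V(G) \ U i) : ℝ) ≤ D) :
    2 * (G.minDegree : ℝ) - 2 * D / l ≤ G.signlessLaplacianEigenvalue 3 := by
  classical
  have hD0 : 0 ≤ D := (Nat.cast_nonneg _).trans (hD 0)
  let p : V(G) → Option (Fin 3) := fun u => if h : ∃ i, (u : α) ∈ U i then some h.choose else none
  have hp : ∀ u i, p u = some i ↔ (u : α) ∈ U i := by
    intro u i
    constructor
    · intro h
      by_cases hex : ∃ i, (u : α) ∈ U i
      · simp only [p, hex, dite_true, Option.some.injEq] at h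
        exact h ▸ hex.choose_spec
      · simp [p, hex] at h
    · intro h
      have hex : ∃ i, (u : α) ∈ U i := ⟨i, h⟩
      simp only [p, hex, dite_true, Option.some.injEq]
      by_contra hij
      exact Set.disjoint_left.1 (hdisj hij) hex.choose_spec h
  choose x hx using hne
  let y : Fin 3 → V(G) := fun i => ⟨x i, hU i (hx i)⟩
  have hy : ∀ i, p (y i) = some i := fun i => (hp _ _).2 (hx i)
  have hcard : 3 ≤ Fintype.card V(G) := by
    have := Fintype.card_le_of_injective y fun i j h => by
      have := hy i
      rw [h, hy j] at this
      exact (Option.some_injective _ this).symm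
    simpa using this
  have hval : ∀ (a : Fin 3 → ℝ) (g : V(G) → ℝ), ∑ u, ((p u).elim 0 a) ^ 2 * g u =
      ∑ i, a i ^ 2 * ∑ u, if p u = some i then g u else 0 := by
    intro a g
    simp only [Finset.mul_sum]
    rw [Finset.sum_comm]
    refine Finset.sum_congr rfl fun u _ => ?_
    cases hpu : p u <;> simp
  -- The test vectors equal `a i` on `U i` and `0` outside the three sets.
  let f : (Fin 3 → ℝ) →ₗ[ℝ] EuclideanSpace ℝ V(G) :=
    { toFun a := WithLp.toLp 2 fun u => (p u).elim 0 a
      map_add' a b := by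
        ext u
        cases h : p u <;> simp [h]
      map_smul' r a := by
        ext u
        cases h : p u <;> simp [h] }
  have hfapp : ∀ a u, f a u = (p u).elim 0 a := fun _ _ => rfl
  have hf : Function.Injective f := by
    intro a b hab
    ext i
    have := congrArg (fun z : EuclideanSpace ℝ V(G) => z (y i)) hab
    simpa [hfapp, hy] using this
  rw [signlessLaplacianEigenvalue, dif_pos ⟨by norm_num, hcard⟩, Matrix.IsHermitian.eigenvalues₀]
  refine LinearMap.IsSymmetric.le_eigenvalues _ _ ⟨3 - 1, by omega⟩ f hf fun a => ?_
  set X : V(G) → ℝ := fun u => (p u).elim 0 a with hX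
  have hnorm : ‖f a‖ ^ 2 = ∑ u, X u ^ 2 := by
    rw [EuclideanSpace.norm_sq_eq]
    simp [hfapp, hX]
  have hinner : inner ℝ (f a) (Matrix.toEuclideanLin G.signlessLaplacian (f a)) =
      ∑ u : V(G), (G.vertexDegree u : ℝ) * X u ^ 2 +
        ∑ u : V(G), ∑ v : V(G), (G.numLinks u v : ℝ) * (X u * X v) := by
    simp only [PiLp.inner_apply, Matrix.toLpLin_apply, RCLike.inner_apply, conj_trivial, hfapp,
      signlessLaplacian, Matrix.add_mulVec, degreeMatrix]
    rw [← Finset.sum_add_distrib]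
    refine Finset.sum_congr rfl fun u _ => ?_
    rw [Pi.add_apply, Matrix.mulVec_diagonal, add_mul]
    congr 1
    · simp only [hfapp, hX]; ring
    · simp only [Matrix.mulVec, dotProduct, adjacencyMatrix, Matrix.of_apply, hfapp, Finset.sum_mul]
      refine Finset.sum_congr rfl fun v _ => ?_
      simp only [hX]; ring
  have hdeg : ∀ u : V(G), (G.vertexDegree u : ℝ) = ∑ v : V(G), (G.numLinks u v : ℝ) := by
    intro u
    rw [vertexDegree_eq_sum]
    push_cast
    rfl
  -- After symmetrising in `u` and `v`, this is equality for pairs in the same part and `(X u + X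
  -- v)² ≥ 0` for the others.
  have hcross : ∑ u : V(G), ∑ v : V(G), (G.numLinks u v : ℝ) * (X u * X v) ≥
      ∑ u : V(G), ∑ v : V(G), (G.numLinks u v : ℝ) * X u ^ 2 -
      2 * ∑ u : V(G), ∑ v : V(G), (G.numLinks u v : ℝ) * (if p u = p v then 0 else X u ^ 2) := by
    have hswap : ∀ H : V(G) → V(G) → ℝ, ∑ u : V(G), ∑ v : V(G), (G.numLinks u v : ℝ) * H u v =
        ∑ u : V(G), ∑ v : V(G), (G.numLinks u v : ℝ) * ((H u v + H v u) / 2) := by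
      intro H
      have h1 : ∑ u : V(G), ∑ v : V(G), (G.numLinks u v : ℝ) * H v u =
          ∑ u : V(G), ∑ v : V(G), (G.numLinks u v : ℝ) * H u v := by
        rw [Finset.sum_comm]
        simp only [G.numLinks_comm]
      have h2 : ∑ u : V(G), ∑ v : V(G), (G.numLinks u v : ℝ) * ((H u v + H v u) / 2) =
          (∑ u : V(G), ∑ v : V(G), (G.numLinks u v : ℝ) * H u v +
            ∑ u : V(G), ∑ v : V(G), (G.numLinks u v : ℝ) * H v u) / 2 := by
        simp only [← Finset.sum_add_distrib, Finset.sum_div]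
        refine Finset.sum_congr rfl fun u _ => Finset.sum_congr rfl fun v _ => by ring
      rw [h2, h1]
      ring
    rw [hswap fun u _ => X u ^ 2, hswap fun u v => if p u = p v then 0 else X u ^ 2]
    simp only [Finset.mul_sum, ← Finset.sum_sub_distrib, ge_iff_le]
    refine Finset.sum_le_sum fun u _ => Finset.sum_le_sum fun v _ => ?_
    rw [mul_left_comm, ← mul_sub]
    refine mul_le_mul_of_nonneg_left ?_ (Nat.cast_nonneg _)
    by_cases huv : p u = p v
    · simp only [huv, if_true, hX]
      linarith
    · simp only [huv, Ne.symm huv, if_false]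
      linarith [sq_nonneg (X u + X v)]
  have hext : ∑ u : V(G), ∑ v : V(G), (G.numLinks u v : ℝ) * (if p u = p v then 0 else X u ^ 2) =
      ∑ i, a i ^ 2 * (G.numEdgesBetween (U i) (V(G) \ U i) : ℝ) := by
    have h1 : ∀ u : V(G), ∑ v : V(G), (G.numLinks u v : ℝ) * (if p u = p v then 0 else X u ^ 2) =
        X u ^ 2 * ∑ v : V(G), if p u = p v then 0 else (G.numLinks u v : ℝ) := by
      intro u
      rw [Finset.mul_sum]
      refine Finset.sum_congr rfl fun v _ => ?_
      split_ifs <;> ring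
    simp only [h1]
    rw [hval]
    refine Finset.sum_congr rfl fun i _ => ?_
    rw [numEdgesBetween_compl_eq_sum]
    push_cast
    congr 1
    refine Finset.sum_congr rfl fun u _ => ?_
    by_cases hu : p u = some i
    · rw [if_pos hu]
      refine Finset.sum_congr rfl fun v _ => ?_
      have h2 : p u = p v ↔ (v : α) ∈ U i := by rw [hu, eq_comm, hp]
      by_cases hv : (v : α) ∈ U i <;> simp [h2, hv, (hp u i).1 hu]
    · rw [if_neg hu]
      simp [mt (hp u i).2 hu]
  have hsq : ∑ u, X u ^ 2 = ∑ i, a i ^ 2 * ((U i).ncard : ℝ) := by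
    have := hval a fun _ => 1
    simp only [mul_one] at this
    rw [hX, this]
    refine Finset.sum_congr rfl fun i _ => ?_
    rw [Finset.sum_boole, ← Set.ncard_coe_finset,
      ← Set.ncard_image_of_injective _ Subtype.val_injective]
    congr 3
    ext z
    simpa [hp] using fun hz => hU i hz
  have hmin : (G.minDegree : ℝ) * ∑ u, X u ^ 2 ≤ ∑ u : V(G), (G.vertexDegree u : ℝ) * X u ^ 2 := by
    rw [Finset.mul_sum]
    exact Finset.sum_le_sum fun u _ => mul_le_mul_of_nonneg_right
      (Nat.cast_le.2 (G.minDegree_le_vertexDegree u)) (sq_nonneg _)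
  have hdeg' : ∑ u : V(G), ∑ v : V(G), (G.numLinks u v : ℝ) * X u ^ 2 =
      ∑ u : V(G), (G.vertexDegree u : ℝ) * X u ^ 2 :=
    Finset.sum_congr rfl fun u _ => by rw [hdeg, Finset.sum_mul]
  -- Each cut has at most `D ≤ (D / l) |U i|` edges.
  have hbound : ∑ i, a i ^ 2 * (G.numEdgesBetween (U i) (V(G) \ U i) : ℝ) ≤
      D / l * ∑ u, X u ^ 2 := by
    rw [hsq, Finset.mul_sum]
    refine Finset.sum_le_sum fun i _ => ?_
    rw [mul_left_comm]
    refine mul_le_mul_of_nonneg_left ((hD i).trans ?_) (sq_nonneg _)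
    rw [div_mul_eq_mul_div, le_div_iff₀ hl]
    exact mul_le_mul_of_nonneg_left (hlU i) hD0
  rw [hnorm, hinner]
  rw [hdeg', hext] at hcross
  have h2 : (2 * (G.minDegree : ℝ) - 2 * D / l) * ∑ u, X u ^ 2 =
      2 * ((G.minDegree : ℝ) * ∑ u, X u ^ 2) - 2 * (D / l * ∑ u, X u ^ 2) := by ring
  rw [h2]
  linarith

/-! ### Cuts of the classes of a partition. -/

/-- The class of a partition of the vertex set, as a set of vertices. -/
def setoidClass (r : Setoid V(G)) (c : Quotient r) : Set α :=
  Subtype.val '' {u : V(G) | (⟦u⟧ : Quotient r) = c}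

theorem coe_mem_setoidClass {r : Setoid V(G)} {c : Quotient r} {u : V(G)} :
    (u : α) ∈ setoidClass r c ↔ (⟦u⟧ : Quotient r) = c := by
  simp [setoidClass]

theorem setoidClass_subset (r : Setoid V(G)) (c : Quotient r) : setoidClass r c ⊆ V(G) := by
  rintro _ ⟨u, -, rfl⟩
  exact u.2

theorem setoidClass_nonempty (r : Setoid V(G)) (c : Quotient r) : (setoidClass r c).Nonempty := by
  induction c using Quotient.inductionOn with | _ u
  exact ⟨u, coe_mem_setoidClass.2 rfl⟩

theorem disjoint_setoidClass {r : Setoid V(G)} {c c' : Quotient r} (h : c ≠ c') :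
    Disjoint (setoidClass r c) (setoidClass r c') := by
  refine Set.disjoint_left.2 ?_
  rintro _ ⟨u, hu, rfl⟩ h'
  exact h (hu.symm.trans (coe_mem_setoidClass.1 h'))

/-- A crossing edge leaves exactly two classes. -/
theorem sum_numEdgesBetween_setoidClass [Finite V(G)] [Finite E(G)] [G.Loopless]
    (r : Setoid V(G)) [Fintype (Quotient r)] :
    ∑ c, G.numEdgesBetween (setoidClass r c) (V(G) \ setoidClass r c) =
      2 * {e | ∃ x y : V(G), G.IsLink e x y ∧ ¬ r x y}.ncard := by
  classical
  have := Fintype.ofFinite V(G)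
  simp only [two_mul_ncard_crossing, numEdgesBetween_compl_eq_sum, coe_mem_setoidClass]
  rw [Finset.sum_comm]
  refine Finset.sum_congr rfl fun u _ => ?_
  rw [Finset.sum_comm]
  refine Finset.sum_congr rfl fun v _ => ?_
  rw [← Finset.mul_sum]
  have h : r u v ↔ (⟦v⟧ : Quotient r) = ⟦u⟧ := by
    rw [eq_comm, Quotient.eq]
  simp only [ite_and, Finset.sum_ite_eq, Finset.mem_univ, if_true, h]
  split_ifs <;> simp_all

/-- If a partition into `p` classes is crossed by fewer than `k (p - 1)` edges, either three of the
classes have fewer than `2k` outgoing edges each, or `κ' < k`. -/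
theorem exists_three_setoidClass_or_edgeConnectivity_lt [Finite V(G)] [Finite E(G)] [G.Loopless]
    {k : ℕ} {r : Setoid V(G)}
    (hr : {e | ∃ x y : V(G), G.IsLink e x y ∧ ¬ r x y}.ncard < k * (Nat.card (Quotient r) - 1)) :
    (∃ c : Fin 3 → Quotient r, Function.Injective c ∧
      ∀ i, G.numEdgesBetween (setoidClass r (c i)) (V(G) \ setoidClass r (c i)) < 2 * k) ∨
    G.edgeConnectivity < k := by
  classical
  have := Fintype.ofFinite (Quotient r)
  set d : Quotient r → ℕ := fun c =>
    G.numEdgesBetween (setoidClass r c) (V(G) \ setoidClass r c) with hd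
  have hsum : ∑ c, d c < 2 * (k * (Nat.card (Quotient r) - 1)) := by
    rw [hd, sum_numEdgesBetween_setoidClass]
    omega
  rw [Nat.card_eq_fintype_card] at hsum hr
  have htwo : 1 < Fintype.card (Quotient r) := by
    by_contra! h
    rw [Nat.sub_eq_zero_of_le h] at hr
    omega
  set small : Finset (Quotient r) := Finset.univ.filter fun c => d c < 2 * k with hsmall
  by_cases h3 : 2 < small.card
  · obtain ⟨a, ha, b, hb, c, hc, hab, hac, hbc⟩ := Finset.two_lt_card.1 h3
    simp only [hsmall, Finset.mem_filter, Finset.mem_univ, true_and] at ha hb hc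
    refine .inl ⟨![a, b, c], ?_, ?_⟩
    · intro i j hij
      fin_cases i <;> fin_cases j <;>
        simp [hab, hac, hbc, hab.symm, hac.symm, hbc.symm] at hij ⊢
    · intro i
      fin_cases i
      · exact ha
      · exact hb
      · exact hc
  right
  by_contra! hk
  have hcut : ∀ c, G.edgeConnectivity ≤ d c := by
    intro c
    refine edgeConnectivity_le (setoidClass_nonempty r c) ⟨setoidClass_subset r c, fun h => ?_⟩
    obtain ⟨c', hc'⟩ := Fintype.exists_ne_of_one_lt_card htwo c
    obtain ⟨x, hx⟩ := setoidClass_nonempty r c'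
    exact Set.disjoint_left.1 (disjoint_setoidClass hc') hx (h (setoidClass_subset r c' hx))
  -- A class that is not small contributes at least `2k`, a small one at least `κ' ≥ k`; with at
  -- most two small ones the total is at least `2k (p - 1)`.
  have hlow : ∑ c, (2 * k - if c ∈ small then k else 0) ≤ ∑ c, d c := by
    refine Finset.sum_le_sum fun c _ => ?_
    have := hcut c
    split_ifs with hc
    · omega
    · simp only [hsmall, Finset.mem_filter, Finset.mem_univ, true_and] at hc
      omega
  have hsplit : ∑ c, (2 * k - if c ∈ small then k else 0) + small.card * k =
      Fintype.card (Quotient r) * (2 * k) := by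
    have hs : small.card * k = ∑ c, if c ∈ small then k else 0 := by simp
    rw [hs, ← Finset.sum_add_distrib, ← smul_eq_mul (Fintype.card _),
      ← Finset.card_univ, ← Finset.sum_const]
    refine Finset.sum_congr rfl fun c _ => ?_
    split_ifs <;> omega
  have hle : small.card * k ≤ 2 * k := Nat.mul_le_mul_right k (by omega)
  obtain ⟨t, ht⟩ := Nat.exists_eq_add_of_lt htwo
  rw [ht] at hsum hsplit
  simp only [Nat.add_sub_cancel_left, Nat.add_assoc] at hsum
  have hexp : (1 + t + 1) * (2 * k) = 2 * k + 2 * (k * (t + 1)) := by ring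
  omega

end Graph

/-! ### The theorem. -/

open Graph

theorem theorem6p8 {α β : Type*} (G : Graph α β) [Fintype V(G)] [DecidableEq V(G)] [Finite E(G)]
    [G.Loopless] (hG : G.HasTwoMinCuts) (k l : ℕ) (hk : 2 ≤ k) (hδ : 2 * k ≤ G.minDegree)
    (hl : l = max ⌈((G.minDegree : ℝ) + 1) / (G.multiplicity : ℝ)⌉₊ 2)
    (hq : G.signlessLaplacianEigenvalue 3 <
      4 * (G.minDegree : ℝ) - 2 * (G.maxDegree : ℝ) - 2 * (3 * (k : ℝ) - 1) / (l : ℝ)) :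
    (k : ℕ∞) ≤ G.treePackingNumber := by
  obtain ⟨V₁, V₂, hne₁, hne₂, hV₁, hV₂, hdisj, hne₃, hκ₁, hκ₂⟩ := hG
  have hne : Nonempty V(G) := ⟨⟨_, hV₁.1 hne₁.some_mem⟩⟩
  have hl2 : 2 ≤ l := hl ▸ le_max_right _ _
  have hl0 : (0 : ℝ) < l := by positivity
  have hsize : ∀ S : Set α, S ⊆ V(G) → S.Nonempty →
      G.numEdgesBetween S (V(G) \ S) < 2 * k → (l : ℝ) ≤ S.ncard := by
    intro S hS hSne hlt
    have hm := minDegree_lt_ncard_mul_multiplicity hS hSne (hlt.trans_le hδ)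
    rw [Nat.cast_le, hl, max_le_iff]
    constructor
    · rw [Nat.ceil_le]
      refine div_le_of_le_mul₀ (Nat.cast_nonneg _) (Nat.cast_nonneg _) ?_
      exact_mod_cast hm
    · exact one_lt_ncard_of_numEdgesBetween_lt_minDegree hS hSne (hlt.trans_le hδ)
  have hthree : ∀ U : Fin 3 → Set α, (∀ i, U i ⊆ V(G)) → (∀ i, (U i).Nonempty) →
      (Pairwise fun i j => Disjoint (U i) (U j)) →
      ¬ ∀ i, G.numEdgesBetween (U i) (V(G) \ U i) < 2 * k := by
    intro U hU hUne hUd hlt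
    -- The cuts have at most `2k - 1` edges; the weaker bound `3k - 1` matches the hypothesis on
    -- `q₃`.
    have h := le_signlessLaplacianEigenvalue_three (D := 3 * k - 1) U hU hUne hUd hl0
      (fun i => hsize _ (hU i) (hUne i) (hlt i)) (fun i => by
        have h1 : (G.numEdgesBetween (U i) (V(G) \ U i) : ℝ) + 1 ≤ 2 * k := by
          exact_mod_cast hlt i
        have : (0 : ℝ) ≤ k := Nat.cast_nonneg k
        linarith)
    have hΔ : (G.minDegree : ℝ) ≤ G.maxDegree := by
      exact_mod_cast (G.minDegree_le_vertexDegree hne.some).trans (vertexDegree_le_maxDegree _)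
    linarith
  refine le_treePackingNumber_of_forall_setoid k fun r => ?_
  by_contra! hr
  rcases exists_three_setoidClass_or_edgeConnectivity_lt hr with ⟨c, hc, hlt⟩ | hlt
  · exact hthree (fun i => setoidClass r (c i)) (fun i => setoidClass_subset r _)
      (fun i => setoidClass_nonempty r _) (fun i j hij => disjoint_setoidClass (hc.ne hij)) hlt
  -- Here `κ' < k`. An edge leaving the third set ends in `V₁` or `V₂`, so its cut has at most `2κ'
  -- < 2k` edges.
  · have hV₃ : G.numEdgesBetween (V(G) \ (V₁ ∪ V₂)) (V(G) \ (V(G) \ (V₁ ∪ V₂))) ≤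
        G.numEdgesBetween V₁ (V(G) \ V₁) + G.numEdgesBetween V₂ (V(G) \ V₂) := by
      refine (Set.ncard_le_ncard ?_ ?_).trans (Set.ncard_union_le _ _)
      · rintro e ⟨x, hx, y, hy, h⟩
        have hxV : x ∉ V₁ ∧ x ∉ V₂ := not_or.1 hx.2
        by_cases hy₁ : y ∈ V₁
        · exact .inl ⟨y, hy₁, x, ⟨hx.1, hxV.1⟩, h.symm⟩
        · have hy₂ : y ∈ V₂ := by
            by_contra hy₂
            exact hy.2 ⟨hy.1, not_or.2 ⟨hy₁, hy₂⟩⟩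
          exact .inr ⟨y, hy₂, x, ⟨hx.1, hxV.2⟩, h.symm⟩
      · refine (Set.toFinite E(G)).subset ?_
        rintro e (⟨x, -, y, -, h⟩ | ⟨x, -, y, -, h⟩) <;> exact h.edge_mem
    refine hthree ![V₁, V₂, V(G) \ (V₁ ∪ V₂)] ?_ ?_ ?_ ?_
    · intro i
      fin_cases i
      exacts [hV₁.1, hV₂.1, Set.sdiff_subset]
    · intro i
      fin_cases i
      exacts [hne₁, hne₂, hne₃]
    · have h13 : Disjoint V₁ (V(G) \ (V₁ ∪ V₂)) :=
        Set.disjoint_left.2 fun x hx h => h.2 (.inl hx)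
      have h23 : Disjoint V₂ (V(G) \ (V₁ ∪ V₂)) :=
        Set.disjoint_left.2 fun x hx h => h.2 (.inr hx)
      intro i j hij
      fin_cases i <;> fin_cases j <;> first | exact absurd rfl hij | skip
      exacts [hdisj, h13, hdisj.symm, h23, h13.symm, h23.symm]
    · intro i
      fin_cases i
      · change G.numEdgesBetween V₁ (V(G) \ V₁) < 2 * k
        omega
      · change G.numEdgesBetween V₂ (V(G) \ V₂) < 2 * k
        omega
      · change G.numEdgesBetween (V(G) \ (V₁ ∪ V₂)) (V(G) \ (V(G) \ (V₁ ∪ V₂))) < 2 * k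
        omega
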